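/- Let $\Omega\subset\mathbb{R}^2$ be open and let $f:\Omega\to\mathbb{R}^3$ be a regular surface of class $C^2$, i.e. $f\in C^2(\Omega)$ and $df_x$ has rank $2$ for every $x\in\Omega$ ($f$ need not be injective). The tangent plane at $x\in\Omega$ is $T_x=\operatorname{im} df_x$. Let $G\subset\mathbb{R}$ be an interval with more than one point (open or not, bounded or not), let $\gamma:G\to\Omega$ be of class $C^2$, and suppose that the curve $\hat\gamma=f\circ\gamma$ on the surface is regular, i.e. $\hat\gamma'(t)\neq0$ for all $t\in G$. The curve is called a geodesic if its velocity is parallel along it, i.e. if for every $t\in G$ the covariant derivative of $\hat\gamma'$, which is the orthogonal projection of $\hat\gamma''(t)$ onto $T_{\gamma(t)}$, vanishes. For a $C^1$ curve $c:[a,b]\to\Omega$ the length of the curve $f\circ c$ on the surface is $\ell(f\circ c)=\int_a^b|(f\circ c)'(t)|\,dt$, and for $P,Q\in\Omega$ the distance $d(P,Q)$ on the surface is the infimum of the lengths of $f\circ c$ over all $C^1$ curves $c:[a,b]\to\Omega$, $a\le b$, with $c(a)=P$ and $c(b)=Q$. For $s\le t$ in $G$, the arc of $\hat\gamma$ on $[s,t]$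 is called minimal if its length equals $d(\gamma(s),\gamma(t))$. Then geodesics are the curves that locally realize the distance between their points: 1. If $\hat\gamma$ is a geodesic, then $|\hat\gamma'|$ is constant on $G$, and for every $t_0\in G$ there is $\varepsilon>0$ such that for all $s\le t$ in $G\cap(t_0-\varepsilon,t_0+\varepsilon)$ the arc of $\hat\gamma$ on $[s,t]$ is minimal. 2. Conversely, if $|\hat\gamma'|$ is constant on $G$ and every $t_0\in G$ has a neighbourhood in $G$ of the form $[s,t]$, with $s<t$ in $G$, on which the arc of $\hat\gamma$ is minimal, then $\hat\gamma$ is a geodesic. (In particular this holds if $G=[a,b]$ and $\hat\gamma$ has constant speed and is minimal between its end points.) -/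

import Mathlib

open Set Topology

noncomputable section

/-- The plane `ℝ²` of the parameters `(u, v)`. -/
abbrev ParamPlane : Type := EuclideanSpace ℝ (Fin 2)

/-- The ambient three-dimensional Euclidean space. -/
abbrev Space3 : Type := EuclideanSpace ℝ (Fin 3)

/-- `f : Ω → ℝ³` is a regular surface (an immersion): `Ω` is open, `f` is of class `C²` on `Ω`
(so that geodesic curvature makes sense), and the Jacobian of `f` has rank two everywhere.
The map `f` is not assumed to be injective. -/
structure IsRegularSurface (f : ParamPlane → Space3) (Ω : Set ParamPlane) : Prop where
  isOpen : IsOpen Ω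
  contDiffOn : ContDiffOn ℝ 2 f Ω
  immersion : ∀ x ∈ Ω, Function.Injective (fderiv ℝ f x)

/-- The tangent plane of the surface `f` at the point of parameter `x`: the span of the two partial
derivatives, i.e. the range of the differential. -/
def tangentPlane (f : ParamPlane → Space3) (x : ParamPlane) : Submodule ℝ Space3 :=
  LinearMap.range (fderiv ℝ f x : ParamPlane →ₗ[ℝ] Space3)

/-- The velocity of the space curve `t ↦ f (γ t)`, `t ∈ G` (one-sided at end points of `G`). -/
def velocity (f : ParamPlane → Space3) (γ : ℝ → ParamPlane) (G : Set ℝ) (t : ℝ) : Space3 :=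
  derivWithin (fun τ => f (γ τ)) G t

/-- The covariant derivative along `f ∘ γ` of a vector field `w` along that curve: the orthogonal
projection of `w'` onto the tangent plane. -/
def covariantDeriv (f : ParamPlane → Space3) (γ : ℝ → ParamPlane) (G : Set ℝ)
    (w : ℝ → Space3) (t : ℝ) : Space3 :=
  (tangentPlane f (γ t)).starProjection (derivWithin w G t)

/-- `γ` describes a regular curve `f ∘ γ : G → Σ` of class `C²` on the surface `f : Ω → Σ`. -/
structure IsRegularCurveOn (f : ParamPlane → Space3) (Ω : Set ParamPlane)
    (γ : ℝ → ParamPlane) (G : Set ℝ) : Prop where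
  contDiffOn : ContDiffOn ℝ 2 γ G
  mapsTo : MapsTo γ G Ω
  regular : ∀ t ∈ G, velocity f γ G t ≠ 0

/-- A geodesic: a regular curve on the surface whose velocity field is parallel along it. -/
def IsGeodesicOn (f : ParamPlane → Space3) (Ω : Set ParamPlane)
    (γ : ℝ → ParamPlane) (G : Set ℝ) : Prop :=
  IsRegularCurveOn f Ω γ G ∧ ∀ t ∈ G, covariantDeriv f γ G (velocity f γ G) t = 0

/-- The length of the arc `f ∘ c` from parameter `a` to parameter `b` (used for `a ≤ b` and `c`
of class `C¹` on `[a, b]`, where the end points do not matter for the integral). -/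
def curveLength (f : ParamPlane → Space3) (c : ℝ → ParamPlane) (a b : ℝ) : ℝ :=
  ∫ t in a..b, ‖deriv (fun τ => f (c τ)) t‖

/-- `c` describes a `C¹` curve `f ∘ c` on the surface `f : Ω → Σ`, defined on `[a, b]`, that joins
the points of parameters `P` and `Q`. The derivative may vanish, so every piecewise `C¹` curve
is included after a reparametrization that stops at its corners. -/
structure JoinsOn (Ω : Set ParamPlane) (P Q : ParamPlane)
    (c : ℝ → ParamPlane) (a b : ℝ) : Prop where
  le : a ≤ b
  contDiffOn : ContDiffOn ℝ 1 c (Icc a b)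
  mapsTo : MapsTo c (Icc a b) Ω
  source : c a = P
  target : c b = Q

/-- The distance on the surface between the points of parameters `P` and `Q`: the infimum of the
lengths of the curves on the surface that join them (only used for points that can be joined). -/
def surfaceDist (f : ParamPlane → Space3) (Ω : Set ParamPlane) (P Q : ParamPlane) : ℝ :=
  sInf {l : ℝ | ∃ (c : ℝ → ParamPlane) (a b : ℝ), JoinsOn Ω P Q c a b ∧ l = curveLength f c a b}

/-- The arc of `f ∘ γ` from parameter `s` to parameter `t` is a curve of minimal length between its
end points: its length is their distance on the surface. -/
def IsMinimalArc (f : ParamPlane → Space3) (Ω : Set ParamPlane)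
    (γ : ℝ → ParamPlane) (s t : ℝ) : Prop :=
  curveLength f γ s t = surfaceDist f Ω (γ s) (γ t)

end

/-! Along a geodesic the velocity is tangent and the acceleration normal to the surface, so the
squared speed has derivative zero.

Minimality comes from comparing energies directly, without geodesic polar coordinates, so that `f`
of class C² suffices. Let `y` be the geodesic and `u` a competitor with the same end points, matched
by a change of parameter `τ`, and put `w = u - y ∘ τ`. Expanding the weighted energy of `u` around
that of `y` gives the positive term `∫ ‖w'‖² / τ'` and a cross term, which integration by parts
turns into the product of `w` with the acceleration of `y`. Chords of a C² surface are tangent to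
second order, so this product is `O(‖w‖²)`; a Poincaré inequality lets the positive term absorb it
on short arcs (`energy_le_energy`). Choosing `τ'` almost proportional to the speed of `u` passes
from energy to length (`length_le_length`). Competitors that leave a small parameter ball are too
long anyway.

For the converse, a minimal arc is displaced in a parameter direction `e`, with a bump as amplitude.
If the acceleration had a positive component along `df e`, this would shorten the arc to first order
(`inner_acceleration_nonpos_of_isMinimalArc`); `e` and `-e` together make the acceleration normal.
-/

section Analysis

/-! ### Energy and length inequalities for curves in a Hilbert space -/

variable {E : Type*} [NormedAddCommGroup E] [InnerProductSpace ℝ E]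

theorem integral_eq_sub_of_hasDerivWithinAt_Icc [CompleteSpace E] {a b : ℝ} (hab : a ≤ b)
    {u p : ℝ → E} (hu : ∀ x ∈ Icc a b, HasDerivWithinAt u (p x) (Icc a b) x)
    (hp : ContinuousOn p (Icc a b)) : ∫ x in a..b, p x = u b - u a :=
  intervalIntegral.integral_eq_sub_of_hasDerivAt_of_le hab
    (fun x hx => (hu x hx).continuousWithinAt)
    (fun x hx => (hu x (Ioo_subset_Icc_self hx)).hasDerivAt (Icc_mem_nhds hx.1 hx.2))
    (hp.intervalIntegrable_of_Icc hab)

/-- The Cauchy–Schwarz inequality with a positive weight. -/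
theorem sq_integral_le_integral_mul_integral_div {a b : ℝ} (hab : a < b) {g ρ : ℝ → ℝ}
    (hg : ContinuousOn g (Icc a b)) (hρ : ContinuousOn ρ (Icc a b))
    (hpos : ∀ x ∈ Icc a b, 0 < ρ x) :
    (∫ x in a..b, g x) ^ 2 ≤ (∫ x in a..b, ρ x) * ∫ x in a..b, g x ^ 2 / ρ x := by
  have hq : ContinuousOn (fun x => g x ^ 2 / ρ x) (Icc a b) :=
    (hg.pow 2).div hρ fun x hx => (hpos x hx).ne'
  have ig := hg.intervalIntegrable_of_Icc (μ := MeasureTheory.volume) hab.le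
  have iρ := hρ.intervalIntegrable_of_Icc (μ := MeasureTheory.volume) hab.le
  have iq := hq.intervalIntegrable_of_Icc (μ := MeasureTheory.volume) hab.le
  have hT : 0 < ∫ x in a..b, ρ x :=
    intervalIntegral.intervalIntegral_pos_of_pos_on iρ
      (fun x hx => hpos x (Ioo_subset_Icc_self hx)) hab
  set T := ∫ x in a..b, ρ x with hTdef
  set I := ∫ x in a..b, g x with hI
  -- Integrate `0 ≤ (g - λρ)² / ρ` with the optimal `λ = I / T`.
  have key : 2 * (I / T) * I ≤ (∫ x in a..b, g x ^ 2 / ρ x) + (I / T) ^ 2 * T := by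
    rw [hI, hTdef, ← intervalIntegral.integral_const_mul, ← intervalIntegral.integral_const_mul,
      ← intervalIntegral.integral_add iq (iρ.const_mul _), ← hI, ← hTdef]
    refine intervalIntegral.integral_mono_on hab.le (ig.const_mul _) (iq.add (iρ.const_mul _)) ?_
    intro x hx
    have h := hpos x hx
    have : g x ^ 2 / ρ x + (I / T) ^ 2 * ρ x - 2 * (I / T) * g x
        = (g x - I / T * ρ x) ^ 2 / ρ x := by field_simp; ring
    have : 0 ≤ (g x - I / T * ρ x) ^ 2 / ρ x := by positivity
    linarith
  have e1 : 2 * (I / T) * I = 2 * (I ^ 2 / T) := by ring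
  have e2 : (I / T) ^ 2 * T = I ^ 2 / T := by field_simp
  rw [e1, e2] at key
  have : I ^ 2 / T ≤ ∫ x in a..b, g x ^ 2 / ρ x := by linarith
  rwa [div_le_iff₀ hT, mul_comm] at this

/-- Weighted Poincaré inequality for a vector function that vanishes at the left end point. -/
theorem norm_sq_le_integral_mul_integral_div [CompleteSpace E] {a b : ℝ} (hab : a < b)
    {w w' : ℝ → E} {ρ : ℝ → ℝ}
    (hw : ∀ x ∈ Icc a b, HasDerivWithinAt w (w' x) (Icc a b) x) (hw' : ContinuousOn w' (Icc a b))
    (hwa : w a = 0) (hρ : ContinuousOn ρ (Icc a b)) (hpos : ∀ x ∈ Icc a b, 0 < ρ x)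
    {x : ℝ} (hx : x ∈ Icc a b) :
    ‖w x‖ ^ 2 ≤ (∫ x in a..b, ρ x) * ∫ x in a..b, ‖w' x‖ ^ 2 / ρ x := by
  refine le_trans ?_ (sq_integral_le_integral_mul_integral_div hab hw'.norm hρ hpos)
  have hsub : Icc a x ⊆ Icc a b := Icc_subset_Icc_right hx.2
  have h := integral_eq_sub_of_hasDerivWithinAt_Icc hx.1
    (fun y hy => (hw y (hsub hy)).mono hsub) (hw'.mono hsub)
  rw [hwa, sub_zero] at h
  have h1 : ‖w x‖ ≤ ∫ y in a..x, ‖w' y‖ := by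
    rw [← h]; exact intervalIntegral.norm_integral_le_integral_norm hx.1
  have h2 : ∫ y in a..x, ‖w' y‖ ≤ ∫ y in a..b, ‖w' y‖ :=
    intervalIntegral.integral_mono_interval le_rfl hx.1 hx.2
      (Filter.Eventually.of_forall fun _ => norm_nonneg _)
      (hw'.norm.intervalIntegrable_of_Icc hab.le)
  gcongr
  exact h1.trans h2

/-- If the acceleration of `y` is almost orthogonal to the chords to `u`, the energy of `u`
is at least the energy of `y`. -/
theorem energy_le_energy [CompleteSpace E] {a b s t v D : ℝ} (hab : a < b)
    {u p y q z : ℝ → E} {τ ρ : ℝ → ℝ}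
    (hu : ∀ x ∈ Icc a b, HasDerivWithinAt u (p x) (Icc a b) x) (hp : ContinuousOn p (Icc a b))
    (hy : ∀ x ∈ Icc s t, HasDerivWithinAt y (q x) (Icc s t) x)
    (hq : ∀ x ∈ Icc s t, HasDerivWithinAt q (z x) (Icc s t) x) (hz : ContinuousOn z (Icc s t))
    (hv : ∀ x ∈ Icc s t, ‖q x‖ = v)
    (hτ : ∀ x ∈ Icc a b, HasDerivWithinAt τ (ρ x) (Icc a b) x) (hρ : ContinuousOn ρ (Icc a b))
    (hpos : ∀ x ∈ Icc a b, 0 < ρ x) (hmaps : MapsTo τ (Icc a b) (Icc s t))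
    (hτa : τ a = s) (hτb : τ b = t) (hua : u a = y s) (hub : u b = y t)
    (hD0 : 0 ≤ D) (hD : ∀ x ∈ Icc a b, |inner ℝ (u x - y (τ x)) (z (τ x))| ≤ D * ‖u x - y (τ x)‖ ^ 2)
    (hDT : 2 * D * (t - s) ^ 2 ≤ 1) :
    v ^ 2 * (t - s) ≤ ∫ x in a..b, ‖p x‖ ^ 2 / ρ x := by
  have hcτ : ContinuousOn τ (Icc a b) := fun x hx => (hτ x hx).continuousWithinAt
  have hcq : ContinuousOn q (Icc s t) := fun x hx => (hq x hx).continuousWithinAt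
  have hcqτ := hcq.comp hcτ hmaps
  have hczτ := hz.comp hcτ hmaps
  set w : ℝ → E := fun x => u x - y (τ x) with hwdef
  set w' : ℝ → E := fun x => p x - ρ x • q (τ x) with hw'def
  have hw : ∀ x ∈ Icc a b, HasDerivWithinAt w (w' x) (Icc a b) x := fun x hx =>
    (hu x hx).sub ((hy _ (hmaps hx)).scomp x (hτ x hx) hmaps)
  have hcw : ContinuousOn w (Icc a b) := fun x hx => (hw x hx).continuousWithinAt
  have hcw' : ContinuousOn w' (Icc a b) := hp.sub (hρ.smul hcqτ)
  have hwa : w a = 0 := by simp [hwdef, hτa, hua]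
  have hwb : w b = 0 := by simp [hwdef, hτb, hub]
  have hT : ∫ x in a..b, ρ x = t - s := by
    rw [integral_eq_sub_of_hasDerivWithinAt_Icc hab.le hτ hρ, hτa, hτb]
  set A := ∫ x in a..b, ‖w' x‖ ^ 2 / ρ x with hA
  have hqA : ContinuousOn (fun x => ‖w' x‖ ^ 2 / ρ x) (Icc a b) :=
    (hcw'.norm.pow 2).div hρ fun x hx => (hpos x hx).ne'
  have hA0 : 0 ≤ A := intervalIntegral.integral_nonneg hab.le fun x hx =>
    div_nonneg (sq_nonneg _) (hpos x hx).le
  have hT0 : 0 < t - s := hT ▸ intervalIntegral.intervalIntegral_pos_of_pos_on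
    (hρ.intervalIntegrable_of_Icc hab.le) (fun x hx => hpos x (Ioo_subset_Icc_self hx)) hab
  have hpoin : ∀ x ∈ Icc a b, ‖w x‖ ^ 2 ≤ (t - s) * A := fun x hx => by
    rw [← hT]; exact norm_sq_le_integral_mul_integral_div hab hw hcw' hwa hρ hpos hx
  have hq' : ∀ x ∈ Icc a b, HasDerivWithinAt (q ∘ τ) (ρ x • z (τ x)) (Icc a b) x := fun x hx =>
    (hq _ (hmaps hx)).scomp x (hτ x hx) hmaps
  -- Integration by parts: `w` vanishes at both ends, so there is no boundary term.
  have hparts := integral_eq_sub_of_hasDerivWithinAt_Icc hab.le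
    (fun x hx => (hw x hx).inner ℝ (hq' x hx))
    ((hcw.inner (hρ.smul hczτ)).add (hcw'.inner hcqτ))
  simp only [hwa, hwb, inner_zero_left, sub_zero] at hparts
  -- Substitute `p = w' + ρ • q(τ)` in `‖p‖² / ρ` and bound `⟨w, z(τ)⟩` by `D (t - s) A`. The terms
  -- are grouped so that the last two brackets integrate to zero: the first because `∫ ρ = t - s`,
  -- the second by parts.
  have hmono : ∫ x in a..b, (v ^ 2 * ρ x + (1 - 2 * D * (t - s) ^ 2) * (‖w' x‖ ^ 2 / ρ x)
      + 2 * (D * (t - s) ^ 2 * (‖w' x‖ ^ 2 / ρ x) - D * (t - s) * A * ρ x)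
      + 2 * (inner ℝ (w x) (ρ x • z (τ x)) + inner ℝ (w' x) (q (τ x))))
      ≤ ∫ x in a..b, ‖p x‖ ^ 2 / ρ x := by
    refine intervalIntegral.integral_mono_on hab.le ?_ ?_ ?_
    · refine ContinuousOn.intervalIntegrable_of_Icc hab.le ?_
      exact (((continuousOn_const.mul hρ).add (continuousOn_const.mul hqA)).add
        (continuousOn_const.mul ((continuousOn_const.mul hqA).sub (continuousOn_const.mul hρ)))).add
        (continuousOn_const.mul ((hcw.inner (hρ.smul hczτ)).add (hcw'.inner hcqτ)))
    · refine ContinuousOn.intervalIntegrable_of_Icc hab.le ?_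
      exact (hp.norm.pow 2).div hρ fun x hx => (hpos x hx).ne'
    · intro x hx
      have hρx := hpos x hx
      have hpx : ‖p x‖ ^ 2 = ‖w' x‖ ^ 2 + 2 * (ρ x * inner ℝ (w' x) (q (τ x))) + ρ x ^ 2 * v ^ 2 := by
        have : p x = w' x + ρ x • q (τ x) := by simp [hw'def]
        rw [this, norm_add_sq_real, real_inner_smul_right, norm_smul, hv _ (hmaps hx), mul_pow,
          Real.norm_eq_abs, sq_abs]
      have hdiv : ‖p x‖ ^ 2 / ρ x = ‖w' x‖ ^ 2 / ρ x + 2 * inner ℝ (w' x) (q (τ x)) + ρ x * v ^ 2 := by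
        rw [hpx]; field_simp
      have h1 : inner ℝ (w x) (z (τ x)) ≤ D * ((t - s) * A) :=
        (le_abs_self _).trans ((hD x hx).trans (mul_le_mul_of_nonneg_left (hpoin x hx) hD0))
      rw [hdiv, real_inner_smul_right]
      nlinarith [mul_le_mul_of_nonneg_left h1 hρx.le]
  have hiA := hqA.intervalIntegrable_of_Icc (μ := MeasureTheory.volume) hab.le
  have hiρ := hρ.intervalIntegrable_of_Icc (μ := MeasureTheory.volume) hab.le
  have hiw : IntervalIntegrable (fun x => inner ℝ (w x) (ρ x • z (τ x)) + inner ℝ (w' x) (q (τ x)))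
      MeasureTheory.volume a b :=
    ((hcw.inner (hρ.smul hczτ)).add (hcw'.inner hcqτ)).intervalIntegrable_of_Icc hab.le
  rw [intervalIntegral.integral_add
      (((hiρ.const_mul _).add (hiA.const_mul _)).add
        (((hiA.const_mul _).sub (hiρ.const_mul _)).const_mul _)) (hiw.const_mul _),
    intervalIntegral.integral_add ((hiρ.const_mul _).add (hiA.const_mul _))
        (((hiA.const_mul _).sub (hiρ.const_mul _)).const_mul _),
    intervalIntegral.integral_add (hiρ.const_mul _) (hiA.const_mul _),
    intervalIntegral.integral_const_mul, intervalIntegral.integral_const_mul,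
    intervalIntegral.integral_const_mul, intervalIntegral.integral_const_mul,
    intervalIntegral.integral_sub (hiA.const_mul _) (hiρ.const_mul _),
    intervalIntegral.integral_const_mul, intervalIntegral.integral_const_mul, ← hA, hT] at hmono
  have hparts' : ∫ x in a..b, (inner ℝ (w x) (ρ x • z (τ x)) + inner ℝ (w' x) (q (τ x))) = 0 := hparts
  rw [hparts'] at hmono
  have : 0 ≤ (1 - 2 * D * (t - s) ^ 2) * A := mul_nonneg (by linarith) hA0
  nlinarith

/-- If the acceleration of a constant speed curve `y` is almost orthogonal to all chords from `y`
to `u`, then `u` is at least as long as `y`. -/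
theorem length_le_length [CompleteSpace E] {a b s t v D : ℝ} (hab : a < b) (hst : s < t)
    {u p y q z : ℝ → E}
    (hu : ∀ x ∈ Icc a b, HasDerivWithinAt u (p x) (Icc a b) x) (hp : ContinuousOn p (Icc a b))
    (hy : ∀ x ∈ Icc s t, HasDerivWithinAt y (q x) (Icc s t) x)
    (hq : ∀ x ∈ Icc s t, HasDerivWithinAt q (z x) (Icc s t) x) (hz : ContinuousOn z (Icc s t))
    (hv : ∀ x ∈ Icc s t, ‖q x‖ = v) (hua : u a = y s) (hub : u b = y t) (hD0 : 0 ≤ D)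
    (hD : ∀ x ∈ Icc a b, ∀ σ ∈ Icc s t, |inner ℝ (u x - y σ) (z σ)| ≤ D * ‖u x - y σ‖ ^ 2)
    (hDT : 2 * D * (t - s) ^ 2 ≤ 1) :
    v * (t - s) ≤ ∫ x in a..b, ‖p x‖ := by
  set l := ∫ x in a..b, ‖p x‖ with hl
  have hl0 : 0 ≤ l := intervalIntegral.integral_nonneg hab.le fun x _ => norm_nonneg _
  have hT0 : 0 < t - s := sub_pos.2 hst
  have hba : 0 < b - a := sub_pos.2 hab
  -- The competitor may stop, so its speed is raised by `δ` to make `τ` strictly increasing; `δ → 0`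
  -- at the end.
  have key : ∀ δ > 0, (v * (t - s)) ^ 2 ≤ (l + δ * (b - a)) * l := by
    intro δ hδ
    -- `projIcc` extends the speed continuously to the whole line, so that `τ` is differentiable
    -- everywhere.
    set g : ℝ → ℝ := fun x => ‖p (projIcc a b hab.le x)‖ + δ with hg
    have hgc : Continuous g :=
      ((hp.domRestrict.comp continuous_projIcc).norm).add continuous_const
    have hgp : ∀ x ∈ Icc a b, g x = ‖p x‖ + δ := fun x hx => by simp [hg, projIcc_of_mem hab.le hx]
    have hip := hp.norm.intervalIntegrable_of_Icc (μ := MeasureTheory.volume) hab.le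
    have hgi : ∫ x in a..b, g x = l + δ * (b - a) := by
      rw [intervalIntegral.integral_congr (g := fun x => ‖p x‖ + δ)
        (fun x hx => hgp x (uIcc_of_le hab.le ▸ hx)), intervalIntegral.integral_add hip (by simp)]
      simp [hl, mul_comm]
    have hS : 0 < l + δ * (b - a) := by positivity
    set S := l + δ * (b - a) with hSdef
    set τ : ℝ → ℝ := fun x => s + (t - s) / S * ∫ r in a..x, g r with hτdef
    have hτ : ∀ x, HasDerivAt τ ((t - s) / S * g x) x := fun x =>
      ((intervalIntegral.integral_hasDerivAt_right (hgc.intervalIntegrable _ _)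
        (hgc.stronglyMeasurableAtFilter _ _) hgc.continuousAt).const_mul _).const_add _
    have hgpos : ∀ x, 0 < g x := fun x => add_pos_of_nonneg_of_pos (norm_nonneg _) hδ
    have hmono : StrictMono τ := strictMono_of_hasDerivAt_pos hτ
      fun x => mul_pos (div_pos hT0 hS) (hgpos x)
    have hτa : τ a = s := by simp [hτdef]
    have hτb : τ b = t := by simp only [hτdef, hgi]; field_simp; ring
    have hmaps : MapsTo τ (Icc a b) (Icc s t) := fun x hx =>
      ⟨hτa ▸ hmono.monotone hx.1, hτb ▸ hmono.monotone hx.2⟩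
    have hρ : Continuous fun x => (t - s) / S * g x := continuous_const.mul hgc
    have hρpos : ∀ x, 0 < (t - s) / S * g x := fun x => mul_pos (div_pos hT0 hS) (hgpos x)
    have h1 := energy_le_energy hab hu hp hy hq hz hv (fun x _ => (hτ x).hasDerivWithinAt)
      hρ.continuousOn (fun x _ => hρpos x) hmaps hτa hτb hua hub hD0
      (fun x hx => hD x hx _ (hmaps hx)) hDT
    have h2 : ∫ x in a..b, ‖p x‖ ^ 2 / ((t - s) / S * g x) ≤ ∫ x in a..b, S / (t - s) * ‖p x‖ := by
      refine intervalIntegral.integral_mono_on hab.le ?_ (hip.const_mul _) ?_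
      · exact ((hp.norm.pow 2).div hρ.continuousOn
          fun x _ => (hρpos x).ne').intervalIntegrable_of_Icc hab.le
      · intro x hx
        rw [div_le_iff₀ (hρpos x)]
        have : S / (t - s) * ‖p x‖ * ((t - s) / S * g x) = ‖p x‖ * g x := by field_simp
        rw [this, hgp x hx]
        nlinarith [norm_nonneg (p x)]
    rw [intervalIntegral.integral_const_mul, ← hl] at h2
    have h3 := h1.trans h2
    have : (v * (t - s)) ^ 2 = v ^ 2 * (t - s) * (t - s) := by ring
    rw [this]
    calc v ^ 2 * (t - s) * (t - s) ≤ S / (t - s) * l * (t - s) := by gcongr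
      _ = S * l := by field_simp
  have hlim : Filter.Tendsto (fun δ : ℝ => (l + δ * (b - a)) * l) (𝓝[>] 0)
      (𝓝 ((l + 0 * (b - a)) * l)) :=
    ((by fun_prop : Continuous fun δ : ℝ => (l + δ * (b - a)) * l).tendsto 0).mono_left
      nhdsWithin_le_nhds
  have h := ge_of_tendsto hlim (eventually_mem_nhdsWithin.mono key)
  refine abs_le_of_sq_le_sq' ?_ hl0 |>.2
  linarith [h, sq l]

/-- First variation inequality: if `u` is not shorter than the constant speed curve `y`. -/
theorem two_mul_integral_inner_le [CompleteSpace E] {s t v : ℝ} (hst : s < t)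
    {u p y q z : ℝ → E}
    (hu : ∀ x ∈ Icc s t, HasDerivWithinAt u (p x) (Icc s t) x) (hp : ContinuousOn p (Icc s t))
    (hy : ∀ x ∈ Icc s t, HasDerivWithinAt y (q x) (Icc s t) x)
    (hq : ∀ x ∈ Icc s t, HasDerivWithinAt q (z x) (Icc s t) x) (hz : ContinuousOn z (Icc s t))
    (hv : ∀ x ∈ Icc s t, ‖q x‖ = v) (hus : u s = y s) (hut : u t = y t)
    (hle : ∫ x in s..t, ‖q x‖ ≤ ∫ x in s..t, ‖p x‖) :
    ∫ x in s..t, (2 * inner ℝ (u x - y x) (z x) - ‖p x - q x‖ ^ 2) ≤ 0 := by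
  have hT0 : 0 < t - s := sub_pos.2 hst
  have hcu : ContinuousOn u (Icc s t) := fun x hx => (hu x hx).continuousWithinAt
  have hcy : ContinuousOn y (Icc s t) := fun x hx => (hy x hx).continuousWithinAt
  have hcq : ContinuousOn q (Icc s t) := fun x hx => (hq x hx).continuousWithinAt
  have hlq : ∫ x in s..t, ‖q x‖ = (t - s) * v := by
    rw [intervalIntegral.integral_congr (g := fun _ => v)
      (fun x hx => hv x (uIcc_of_le hst.le ▸ hx))]
    simp
  have hv0 : 0 ≤ v := hv s (left_mem_Icc.2 hst.le) ▸ norm_nonneg _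
  -- With weight `1`, the length inequality becomes an energy inequality, because `q` has constant
  -- norm.
  have hcs := sq_integral_le_integral_mul_integral_div hst hp.norm
    (continuousOn_const (c := (1 : ℝ))) (fun _ _ => one_pos)
  simp only [intervalIntegral.integral_const, smul_eq_mul, mul_one, div_one] at hcs
  rw [hlq] at hle
  have h1 : (t - s) * v ^ 2 ≤ ∫ x in s..t, ‖p x‖ ^ 2 := by
    have : ((t - s) * v) ^ 2 ≤ (∫ x in s..t, ‖p x‖) ^ 2 := by gcongr
    have h := this.trans hcs
    have e : ((t - s) * v) ^ 2 = (t - s) * ((t - s) * v ^ 2) := by ring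
    rw [e] at h
    exact le_of_mul_le_mul_left h hT0
  have hparts := integral_eq_sub_of_hasDerivWithinAt_Icc hst.le
    (fun x hx => ((hu x hx).sub (hy x hx)).inner ℝ (hq x hx))
    (((hcu.sub hcy).inner hz).add ((hp.sub hcq).inner hcq))
  have hparts' : ∫ x in s..t, (inner ℝ (u x - y x) (z x) + inner ℝ (p x - q x) (q x)) = 0 :=
    hparts.trans (by simp [hus, hut])
  -- Expanding `‖p‖²` around `q` isolates the expression that integrates to zero by parts; what
  -- remains is the difference of the energies.
  have e : ∫ x in s..t, (2 * inner ℝ (u x - y x) (z x) - ‖p x - q x‖ ^ 2)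
      = ∫ x in s..t, (2 * (inner ℝ (u x - y x) (z x) + inner ℝ (p x - q x) (q x))
        - ‖p x‖ ^ 2 + v ^ 2) := by
    refine intervalIntegral.integral_congr fun x hx => ?_
    have hx' : x ∈ Icc s t := uIcc_of_le hst.le ▸ hx
    have : ‖p x‖ ^ 2 = ‖p x - q x‖ ^ 2 + 2 * inner ℝ (p x - q x) (q x) + v ^ 2 := by
      rw [← hv x hx', ← norm_add_sq_real, sub_add_cancel]
    rw [this]; ring
  have i1 : IntervalIntegrable
      (fun x => inner ℝ (u x - y x) (z x) + inner ℝ (p x - q x) (q x)) MeasureTheory.volume s t :=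
    (((hcu.sub hcy).inner hz).add ((hp.sub hcq).inner hcq)).intervalIntegrable_of_Icc hst.le
  have i2 : IntervalIntegrable (fun x => ‖p x‖ ^ 2) MeasureTheory.volume s t :=
    (hp.norm.pow 2).intervalIntegrable_of_Icc hst.le
  rw [e, intervalIntegral.integral_add ((i1.const_mul _).sub i2) (by simp),
    intervalIntegral.integral_sub (i1.const_mul _) i2, intervalIntegral.integral_const_mul, hparts']
  simp only [intervalIntegral.integral_const, smul_eq_mul]
  linarith

end Analysis

/-! ### Local bounds for a C² immersion -/

/-- Quantitative `C²` immersion bounds for `f` on the ball of radius `r` around `x₀`. -/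
structure ImmersionBounds (f : ParamPlane → Space3) (Ω : Set ParamPlane) (x₀ : ParamPlane)
    (r m K M : ℝ) : Prop where
  r_pos : 0 < r
  m_pos : 0 < m
  K_nonneg : 0 ≤ K
  subset : Metric.ball x₀ r ⊆ Ω
  norm_fderiv_le : ∀ x ∈ Metric.ball x₀ r, ‖fderiv ℝ f x‖ ≤ M
  lipschitz : ∀ x ∈ Metric.ball x₀ r, ∀ y ∈ Metric.ball x₀ r,
    ‖fderiv ℝ f x - fderiv ℝ f y‖ ≤ K * ‖x - y‖
  taylor : ∀ x ∈ Metric.ball x₀ r, ∀ y ∈ Metric.ball x₀ r,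
    ‖f x - f y - fderiv ℝ f y (x - y)‖ ≤ K * ‖x - y‖ ^ 2
  antilipschitz : ∀ x ∈ Metric.ball x₀ r, ∀ y ∈ Metric.ball x₀ r, m * ‖x - y‖ ≤ ‖f x - f y‖

namespace IsRegularSurface

variable {f : ParamPlane → Space3} {Ω : Set ParamPlane}

theorem contDiffAt (hf : IsRegularSurface f Ω) {x : ParamPlane} (hx : x ∈ Ω) :
    ContDiffAt ℝ 2 f x :=
  hf.contDiffOn.contDiffAt (hf.isOpen.mem_nhds hx)

theorem hasFDerivAt (hf : IsRegularSurface f Ω) {x : ParamPlane} (hx : x ∈ Ω) :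
    HasFDerivAt f (fderiv ℝ f x) x :=
  ((hf.contDiffAt hx).differentiableAt (by norm_num)).hasFDerivAt

theorem continuousOn_fderiv (hf : IsRegularSurface f Ω) : ContinuousOn (fderiv ℝ f) Ω := fun _ hx =>
  ((hf.contDiffAt hx).fderiv_right (m := 1) (by norm_num)).continuousAt.continuousWithinAt

/-- The derivative of `f` is C¹, hence locally Lipschitz, which gives the Taylor bound on a convex
ball. The differential at `x₀` is injective on a finite-dimensional space, hence bounded below by `1
/ c`, and on a small ball the errors do not destroy this bound. -/
theorem exists_immersionBounds (hf : IsRegularSurface f Ω) {x₀ : ParamPlane} (hx₀ : x₀ ∈ Ω) :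
    ∃ r m K M : ℝ, ImmersionBounds f Ω x₀ r m K M := by
  obtain ⟨K, S, hS, hlip⟩ :=
    ((hf.contDiffAt hx₀).fderiv_right (m := 1) (by norm_num)).exists_lipschitzOnWith
  obtain ⟨c, hc, hanti⟩ := LinearMap.exists_antilipschitzWith
    (fderiv ℝ f x₀ : ParamPlane →ₗ[ℝ] Space3) (LinearMap.ker_eq_bot.2 (hf.immersion x₀ hx₀))
  obtain ⟨R, hR, hRS⟩ := Metric.mem_nhds_iff.1 (Filter.inter_mem hS (hf.isOpen.mem_nhds hx₀))
  have hc' : (0 : ℝ) < c := hc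
  have hK0 : (0 : ℝ) ≤ K := K.2
  -- This makes `K * r ≤ 1 / (6c)`; the `+ 1` covers `K = 0`. Of the lower bound `6 / (6c)`, the
  -- Taylor remainder costs two sixths and the change of the differential one, which leaves `1 /
  -- (2c)`.
  set r := min R (1 / (6 * c * (K + 1))) with hr
  have hr0 : 0 < r := lt_min hR (by positivity)
  have hsub : Metric.ball x₀ r ⊆ S ∩ Ω := (Metric.ball_subset_ball (min_le_left _ _)).trans hRS
  have hlip' : ∀ x ∈ Metric.ball x₀ r, ∀ y ∈ Metric.ball x₀ r,
      ‖fderiv ℝ f x - fderiv ℝ f y‖ ≤ K * ‖x - y‖ := fun x hx y hy =>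
    hlip.norm_sub_le (hsub hx).1 (hsub hy).1
  have htaylor : ∀ x ∈ Metric.ball x₀ r, ∀ y ∈ Metric.ball x₀ r,
      ‖f x - f y - fderiv ℝ f y (x - y)‖ ≤ K * ‖x - y‖ ^ 2 := by
    intro x hx y hy
    have hseg := (convex_ball x₀ r).segment_subset hy hx
    have h := (convex_segment y x).norm_image_sub_le_of_norm_fderiv_le' (f := f) (𝕜 := ℝ)
      (φ := fderiv ℝ f y) (C := K * ‖x - y‖)
      (fun w hw => (hf.hasFDerivAt (hsub (hseg hw)).2).differentiableAt)
      (fun w hw => (hlip' w (hseg hw) y hy).trans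
        (mul_le_mul_of_nonneg_left (norm_sub_le_of_mem_segment hw) hK0))
      (left_mem_segment ℝ y x) (right_mem_segment ℝ y x)
    rwa [mul_assoc, ← sq] at h
  refine ⟨r, 1 / (2 * c), K, ‖fderiv ℝ f x₀‖ + K * r, hr0, by positivity, hK0,
    fun x hx => (hsub hx).2, ?_, hlip', htaylor, ?_⟩
  · intro x hx
    have h1 := hlip' x hx x₀ (Metric.mem_ball_self hr0)
    have h2 : ‖x - x₀‖ ≤ r := (mem_ball_iff_norm.1 hx).le
    have h3 := norm_le_norm_add_norm_sub (fderiv ℝ f x₀) (fderiv ℝ f x)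
    rw [norm_sub_rev (fderiv ℝ f x₀)] at h3
    have h4 : (K : ℝ) * ‖x - x₀‖ ≤ K * r := by gcongr
    linarith
  · intro x hx y hy
    have h1 := htaylor x hx y hy
    have h2 := (fderiv ℝ f y - fderiv ℝ f x₀).le_of_opNorm_le
      (hlip' y hy x₀ (Metric.mem_ball_self hr0)) (x - y)
    have h3 : ‖x - y‖ ≤ c * ‖fderiv ℝ f x₀ (x - y)‖ := by
      rw [map_sub, ← dist_eq_norm, ← dist_eq_norm]
      exact hanti.le_mul_dist x y
    have hy' : ‖y - x₀‖ ≤ r := (mem_ball_iff_norm.1 hy).le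
    have hx' : ‖x - x₀‖ ≤ r := (mem_ball_iff_norm.1 hx).le
    have hxy : ‖x - y‖ ≤ 2 * r := by
      have := norm_sub_le_norm_sub_add_norm_sub x x₀ y
      rw [norm_sub_rev x₀ y] at this; linarith
    have hrK : K * r ≤ 1 / (6 * c) := by
      calc (K : ℝ) * r ≤ (K + 1) * (1 / (6 * c * (K + 1))) := by
            gcongr
            · linarith
            · exact min_le_right _ _
        _ = 1 / (6 * c) := by field_simp
    have h4 : K * ‖x - y‖ ^ 2 ≤ 2 * (1 / (6 * c)) * ‖x - y‖ := by
      calc K * ‖x - y‖ ^ 2 = K * ‖x - y‖ * ‖x - y‖ := by ring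
        _ ≤ K * (2 * r) * ‖x - y‖ := by gcongr
        _ = 2 * (K * r) * ‖x - y‖ := by ring
        _ ≤ _ := by gcongr
    have h5 : K * ‖y - x₀‖ * ‖x - y‖ ≤ 1 / (6 * c) * ‖x - y‖ := by
      calc K * ‖y - x₀‖ * ‖x - y‖ ≤ K * r * ‖x - y‖ := by gcongr
        _ ≤ _ := by gcongr
    have h6 : 1 / c * ‖x - y‖ ≤ ‖fderiv ℝ f x₀ (x - y)‖ := by
      rw [one_div, inv_mul_le_iff₀ hc']; exact h3
    have h7 : ‖fderiv ℝ f x₀ (x - y)‖ ≤ ‖f x - f y‖ + ‖f x - f y - fderiv ℝ f y (x - y)‖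
        + ‖(fderiv ℝ f y - fderiv ℝ f x₀) (x - y)‖ := by
      have : fderiv ℝ f x₀ (x - y) = (f x - f y) - (f x - f y - fderiv ℝ f y (x - y))
        - (fderiv ℝ f y - fderiv ℝ f x₀) (x - y) := by
        rw [sub_apply]; abel
      rw [this]
      exact (norm_sub_le _ _).trans (add_le_add_left (norm_sub_le _ _) _)
    have e1 : 1 / c * ‖x - y‖ = 6 * (1 / (6 * c) * ‖x - y‖) := by field_simp
    have e2 : 1 / (2 * c) * ‖x - y‖ = 3 * (1 / (6 * c) * ‖x - y‖) := by field_simp; ring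
    rw [e2]; rw [e1] at h6
    linarith

end IsRegularSurface

/-- Chords are almost orthogonal to vectors normal to the surface. -/
theorem ImmersionBounds.abs_inner_le {f : ParamPlane → Space3} {Ω : Set ParamPlane}
    {x₀ : ParamPlane} {r m K M : ℝ} (h : ImmersionBounds f Ω x₀ r m K M) {x y : ParamPlane}
    (hx : x ∈ Metric.ball x₀ r) (hy : y ∈ Metric.ball x₀ r) {n : Space3} {Z : ℝ} (hn : ‖n‖ ≤ Z)
    (hort : ∀ e, inner ℝ (fderiv ℝ f y e) n = 0) :
    |inner ℝ (f x - f y) n| ≤ K * Z / m ^ 2 * ‖f x - f y‖ ^ 2 := by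
  have hm := h.m_pos
  have hK := h.K_nonneg
  have hZ : 0 ≤ Z := (norm_nonneg n).trans hn
  have h1 : inner ℝ (f x - f y) n = inner ℝ (f x - f y - fderiv ℝ f y (x - y)) n := by
    rw [inner_sub_left (f x - f y), hort, sub_zero]
  rw [h1]
  calc _ ≤ ‖f x - f y - fderiv ℝ f y (x - y)‖ * ‖n‖ := abs_real_inner_le_norm _ _
    _ ≤ K * ‖x - y‖ ^ 2 * Z := by
        gcongr
        exact h.taylor x hx y hy
    _ = K * Z / m ^ 2 * (m * ‖x - y‖) ^ 2 := by field_simp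
    _ ≤ _ := by
        gcongr
        exact h.antilipschitz x hx y hy

/-! ### Curves on the surface, their lengths and the distance -/

section Curves

variable {f : ParamPlane → Space3} {Ω : Set ParamPlane}

theorem Set.OrdConnected.uniqueDiffOn {G : Set ℝ} (hG : G.OrdConnected) (hG' : G.Nontrivial) :
    UniqueDiffOn ℝ G := by
  obtain ⟨s, hs, t, ht, hst⟩ := hG'.exists_lt
  refine uniqueDiffOn_convex hG.convex ?_
  obtain ⟨x, hx⟩ := nonempty_Ioo.2 hst
  exact ⟨x, interior_maximal (Ioo_subset_Icc_self.trans (hG.out hs ht)) isOpen_Ioo hx⟩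

theorem hasDerivWithinAt_comp (hf : IsRegularSurface f Ω) {c : ℝ → ParamPlane} {S : Set ℝ}
    (hc : ContDiffOn ℝ 1 c S) (hmaps : MapsTo c S Ω) {x : ℝ} (hx : x ∈ S) :
    HasDerivWithinAt (fun τ => f (c τ)) (fderiv ℝ f (c x) (derivWithin c S x)) S x :=
  (hf.hasFDerivAt (hmaps hx)).comp_hasDerivWithinAt x
    (hc.differentiableOn (by norm_num) x hx).hasDerivWithinAt

theorem continuousOn_fderiv_derivWithin (hf : IsRegularSurface f Ω) {c : ℝ → ParamPlane}
    {S : Set ℝ} (hS : UniqueDiffOn ℝ S) (hc : ContDiffOn ℝ 1 c S) (hmaps : MapsTo c S Ω) :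
    ContinuousOn (fun x => fderiv ℝ f (c x) (derivWithin c S x)) S :=
  (hf.continuousOn_fderiv.comp hc.continuousOn hmaps).clm_apply
    (hc.continuousOn_derivWithin hS (by norm_num))

theorem curveLength_eq {c : ℝ → ParamPlane} {a b : ℝ} (hab : a ≤ b) {p : ℝ → Space3}
    (h : ∀ x ∈ Icc a b, HasDerivWithinAt (fun τ => f (c τ)) (p x) (Icc a b) x) :
    curveLength f c a b = ∫ x in a..b, ‖p x‖ :=
  intervalIntegral.integral_congr_Ioo_of_le hab fun x hx => by
    rw [((h x (Ioo_subset_Icc_self hx)).hasDerivAt (Icc_mem_nhds hx.1 hx.2)).deriv]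

theorem curveLength_nonneg {c : ℝ → ParamPlane} {a b : ℝ} (hab : a ≤ b) :
    0 ≤ curveLength f c a b :=
  intervalIntegral.integral_nonneg hab fun _ _ => norm_nonneg _

theorem surfaceDist_le_curveLength {c : ℝ → ParamPlane} {a b : ℝ} {P Q : ParamPlane}
    (h : JoinsOn Ω P Q c a b) : surfaceDist f Ω P Q ≤ curveLength f c a b :=
  csInf_le ⟨0, by rintro _ ⟨c, a, b, h, rfl⟩; exact curveLength_nonneg h.le⟩ ⟨c, a, b, h, rfl⟩

/-- To bound the distance from below it suffices to consider non-degenerate intervals. -/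
theorem le_surfaceDist {P Q : ParamPlane} {l : ℝ}
    (hne : ∃ c a b, JoinsOn Ω P Q c a b)
    (h : ∀ c a b, a < b → JoinsOn Ω P Q c a b → l ≤ curveLength f c a b) :
    l ≤ surfaceDist f Ω P Q := by
  obtain ⟨c, a, b, hc⟩ := hne
  refine le_csInf ⟨_, c, a, b, hc, rfl⟩ ?_
  rintro _ ⟨c, a, b, hc, rfl⟩
  rcases hc.le.lt_or_eq with hab | rfl
  · exact h c a b hab hc
  -- On a degenerate interval `P = Q`, and the constant curve on `[0, 1]` has the same length, zero.
  · have hP : P ∈ Ω := hc.source ▸ hc.mapsTo (left_mem_Icc.2 le_rfl)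
    have := h (fun _ => P) 0 1 one_pos ⟨zero_le_one, contDiffOn_const, fun _ _ => hP, rfl,
      hc.source.symm.trans hc.target⟩
    simpa [curveLength] using this

/-- Used to show that a competitor leaving a small parameter ball is long. -/
theorem norm_sub_le_curveLength (hf : IsRegularSurface f Ω) {c : ℝ → ParamPlane} {a b : ℝ}
    (hab : a < b) (hc : ContDiffOn ℝ 1 c (Icc a b)) (hmaps : MapsTo c (Icc a b) Ω) {x : ℝ}
    (hx : x ∈ Icc a b) : ‖f (c x) - f (c a)‖ ≤ curveLength f c a b := by
  have hd := fun x (hx : x ∈ Icc a b) => hasDerivWithinAt_comp hf hc hmaps hx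
  have hp := continuousOn_fderiv_derivWithin hf (uniqueDiffOn_Icc hab) hc hmaps
  rw [curveLength_eq hab.le hd]
  have hsub : Icc a x ⊆ Icc a b := Icc_subset_Icc_right hx.2
  rw [← integral_eq_sub_of_hasDerivWithinAt_Icc hx.1
    (fun y hy => (hd y (hsub hy)).mono hsub) (hp.mono hsub)]
  exact (intervalIntegral.norm_integral_le_integral_norm hx.1).trans
    (intervalIntegral.integral_mono_interval le_rfl hx.1 hx.2
      (Filter.Eventually.of_forall fun _ => norm_nonneg _)
      (hp.norm.intervalIntegrable_of_Icc hab.le))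

namespace IsRegularCurveOn

variable {γ : ℝ → ParamPlane} {G : Set ℝ}

theorem contDiffOn_comp (hf : IsRegularSurface f Ω) (hγ : IsRegularCurveOn f Ω γ G) :
    ContDiffOn ℝ 2 (fun τ => f (γ τ)) G :=
  hf.contDiffOn.comp hγ.contDiffOn hγ.mapsTo

theorem hasDerivWithinAt (hf : IsRegularSurface f Ω) (hγ : IsRegularCurveOn f Ω γ G) {x : ℝ}
    (hx : x ∈ G) : HasDerivWithinAt (fun τ => f (γ τ)) (velocity f γ G x) G x :=
  ((hγ.contDiffOn_comp hf).differentiableOn (by norm_num) x hx).hasDerivWithinAt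

theorem contDiffOn_velocity (hf : IsRegularSurface f Ω) (hγ : IsRegularCurveOn f Ω γ G)
    (hG : UniqueDiffOn ℝ G) : ContDiffOn ℝ 1 (velocity f γ G) G :=
  (hγ.contDiffOn_comp hf).derivWithin hG (by norm_num)

theorem hasDerivWithinAt_velocity (hf : IsRegularSurface f Ω) (hγ : IsRegularCurveOn f Ω γ G)
    (hG : UniqueDiffOn ℝ G) {x : ℝ} (hx : x ∈ G) :
    HasDerivWithinAt (velocity f γ G) (derivWithin (velocity f γ G) G x) G x :=
  ((hγ.contDiffOn_velocity hf hG).differentiableOn (by norm_num) x hx).hasDerivWithinAt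

theorem continuousOn_acceleration (hf : IsRegularSurface f Ω) (hγ : IsRegularCurveOn f Ω γ G)
    (hG : UniqueDiffOn ℝ G) : ContinuousOn (derivWithin (velocity f γ G) G) G :=
  (hγ.contDiffOn_velocity hf hG).continuousOn_derivWithin hG (by norm_num)

theorem velocity_eq (hf : IsRegularSurface f Ω) (hγ : IsRegularCurveOn f Ω γ G)
    (hG : UniqueDiffOn ℝ G) {x : ℝ} (hx : x ∈ G) :
    velocity f γ G x = fderiv ℝ f (γ x) (derivWithin γ G x) :=
  (hasDerivWithinAt_comp hf (hγ.contDiffOn.of_le (by norm_num)) hγ.mapsTo hx).derivWithin (hG x hx)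

theorem curveLength_eq (hf : IsRegularSurface f Ω) (hγ : IsRegularCurveOn f Ω γ G) {s t : ℝ}
    (hst : s ≤ t) (hsub : Icc s t ⊆ G) :
    curveLength f γ s t = ∫ x in s..t, ‖velocity f γ G x‖ :=
  _root_.curveLength_eq hst fun _ hx => (hγ.hasDerivWithinAt hf (hsub hx)).mono hsub

theorem curveLength_eq_mul (hf : IsRegularSurface f Ω) (hγ : IsRegularCurveOn f Ω γ G) {s t v : ℝ}
    (hst : s ≤ t) (hsub : Icc s t ⊆ G) (hv : ∀ x ∈ G, ‖velocity f γ G x‖ = v) :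
    curveLength f γ s t = v * (t - s) := by
  rw [hγ.curveLength_eq hf hst hsub, intervalIntegral.integral_congr (g := fun _ => v)
    (fun x hx => hv x (hsub (uIcc_of_le hst ▸ hx)))]
  simp [mul_comm]

theorem joinsOn (hγ : IsRegularCurveOn f Ω γ G) {s t : ℝ} (hst : s ≤ t) (hsub : Icc s t ⊆ G) :
    JoinsOn Ω (γ s) (γ t) γ s t :=
  ⟨hst, (hγ.contDiffOn.mono hsub).of_le (by norm_num), hγ.mapsTo.mono_left hsub, rfl, rfl⟩

end IsRegularCurveOn

theorem covariantDeriv_eq_zero_iff {γ : ℝ → ParamPlane} {G : Set ℝ} {w : ℝ → Space3} {t : ℝ} :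
    covariantDeriv f γ G w t = 0 ↔ ∀ e, inner ℝ (fderiv ℝ f (γ t) e) (derivWithin w G t) = 0 := by
  rw [covariantDeriv, Submodule.starProjection_apply_eq_zero_iff, Submodule.mem_orthogonal]
  simp [tangentPlane]

/-! ### Geodesics have constant speed and are locally minimal -/

/-- Geodesics have constant speed. -/
theorem IsGeodesicOn.exists_norm_velocity_eq {γ : ℝ → ParamPlane} {G : Set ℝ}
    (hf : IsRegularSurface f Ω) (hG : G.OrdConnected) (hG' : G.Nontrivial)
    (h : IsGeodesicOn f Ω γ G) : ∃ v : ℝ, ∀ t ∈ G, ‖velocity f γ G t‖ = v := by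
  obtain ⟨hγ, hgeo⟩ := h
  have hU := hG.uniqueDiffOn hG'
  obtain ⟨t₁, ht₁⟩ := hG'.nonempty
  have hd : ∀ t ∈ G, HasDerivWithinAt
      (fun t => inner ℝ (velocity f γ G t) (velocity f γ G t) : ℝ → ℝ) 0 G t := by
    intro t ht
    have h0 : inner ℝ (velocity f γ G t) (derivWithin (velocity f γ G) G t) = 0 := by
      nth_rewrite 1 [hγ.velocity_eq hf hU ht]
      exact covariantDeriv_eq_zero_iff.1 (hgeo t ht) _
    have h1 := hγ.hasDerivWithinAt_velocity hf hU ht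
    have h2 := h1.inner ℝ h1
    rwa [h0, real_inner_comm, h0, add_zero] at h2
  refine ⟨‖velocity f γ G t₁‖, fun t ht => ?_⟩
  have h := hG.convex.is_const_of_fderivWithin_eq_zero (𝕜 := ℝ)
    (fun t ht => (hd t ht).differentiableWithinAt)
    (fun t ht => by
      have := (hd t ht).hasFDerivWithinAt.fderivWithin (hU t ht)
      rw [this]; ext; simp) ht ht₁
  simp only [real_inner_self_eq_norm_sq] at h
  exact (sq_eq_sq₀ (norm_nonneg _) (norm_nonneg _)).1 h

/-- Short arcs of geodesics are minimal. -/
theorem IsGeodesicOn.exists_isMinimalArc {γ : ℝ → ParamPlane} {G : Set ℝ} {v : ℝ}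
    (hf : IsRegularSurface f Ω) (hG : G.OrdConnected) (hG' : G.Nontrivial)
    (h : IsGeodesicOn f Ω γ G) (hv : ∀ t ∈ G, ‖velocity f γ G t‖ = v) {t₀ : ℝ} (ht₀ : t₀ ∈ G) :
    ∃ ε > 0, ∀ s ∈ G, ∀ t ∈ G, |s - t₀| < ε → |t - t₀| < ε → s ≤ t → IsMinimalArc f Ω γ s t := by
  obtain ⟨hγ, hgeo⟩ := h
  have hU := hG.uniqueDiffOn hG'
  obtain ⟨r, m, K, M, hB⟩ := hf.exists_immersionBounds (hγ.mapsTo ht₀)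
  have hr := hB.r_pos
  have hm := hB.m_pos
  have hK := hB.K_nonneg
  have hv0 : 0 ≤ v := hv t₀ ht₀ ▸ norm_nonneg _
  set z := derivWithin (velocity f γ G) G with hz
  set Z := ‖z t₀‖ + 1 with hZ
  have hZ0 : 0 < Z := by positivity
  set D := K * Z / m ^ 2 with hD
  have hD0 : 0 ≤ D := by positivity
  have hcz := hγ.continuousOn_acceleration hf hU
  have e1 : ∀ᶠ t in 𝓝[G] t₀, ‖z t‖ < Z := (hcz t₀ ht₀).norm.eventually (gt_mem_nhds (lt_add_one _))
  have e2 : ∀ᶠ t in 𝓝[G] t₀, γ t ∈ Metric.ball (γ t₀) (r / 2) :=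
    (hγ.contDiffOn.continuousOn t₀ ht₀) (Metric.ball_mem_nhds _ (by positivity))
  obtain ⟨ε₁, hε₁, hball⟩ := Metric.mem_nhdsWithin_iff.1 (e1.and e2)
  -- Here `2ε` bounds `t - s`. This condition allows the absorption in the energy estimate; the next
  -- one makes the arc shorter than any competitor that leaves the ball.
  have e3 : ∀ᶠ ε : ℝ in 𝓝[>] 0, 2 * D * (2 * ε) ^ 2 < 1 := by
    have : Filter.Tendsto (fun ε : ℝ => 2 * D * (2 * ε) ^ 2) (𝓝 0) (𝓝 (2 * D * (2 * 0) ^ 2)) :=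
      (by fun_prop : Continuous fun ε : ℝ => 2 * D * (2 * ε) ^ 2).tendsto 0
    exact (this.mono_left nhdsWithin_le_nhds).eventually (gt_mem_nhds (by norm_num))
  have e4 : ∀ᶠ ε : ℝ in 𝓝[>] 0, v * (2 * ε) < m * (r / 4) := by
    have : Filter.Tendsto (fun ε : ℝ => v * (2 * ε)) (𝓝 0) (𝓝 (v * (2 * 0))) :=
      (by fun_prop : Continuous fun ε : ℝ => v * (2 * ε)).tendsto 0
    exact (this.mono_left nhdsWithin_le_nhds).eventually
      (gt_mem_nhds (by rw [mul_zero, mul_zero]; positivity))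
  have e5 : ∀ᶠ ε : ℝ in 𝓝[>] 0, ε < ε₁ := nhdsWithin_le_nhds (gt_mem_nhds hε₁)
  obtain ⟨ε, ⟨⟨hε3, hε4⟩, hε5⟩, hε⟩ := (((e3.and e4).and e5).and eventually_mem_nhdsWithin).exists
  have hε : 0 < ε := hε
  refine ⟨ε, hε, fun s hs t ht hsε htε hst => ?_⟩
  have hsub : Icc s t ⊆ G := hG.out hs ht
  refine le_antisymm ?_ (surfaceDist_le_curveLength (hγ.joinsOn hst hsub))
  rw [hγ.curveLength_eq_mul hf hst hsub hv]
  refine le_surfaceDist ⟨_, _, _, hγ.joinsOn hst hsub⟩ fun c a b hab hc => ?_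
  rw [abs_lt] at hsε htε
  have hTε : t - s ≤ 2 * ε := by linarith
  have hT0 : 0 ≤ t - s := sub_nonneg.2 hst
  rcases hst.eq_or_lt with rfl | hst'
  · rw [sub_self, mul_zero]; exact curveLength_nonneg hab.le
  have hnear : ∀ σ ∈ Icc s t, ‖z σ‖ < Z ∧ γ σ ∈ Metric.ball (γ t₀) (r / 2) := fun σ hσ =>
    hball ⟨by rw [Metric.mem_ball, Real.dist_eq, abs_lt]; constructor <;> linarith [hσ.1, hσ.2],
      hsub hσ⟩
  have hrr : Metric.ball (γ t₀) (r / 2) ⊆ Metric.ball (γ t₀) r :=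
    Metric.ball_subset_ball (by linarith)
  by_cases hin : MapsTo c (Icc a b) (Metric.ball (γ t₀) r)
  · have hd := fun x (hx : x ∈ Icc a b) => hasDerivWithinAt_comp hf hc.contDiffOn hc.mapsTo hx
    rw [curveLength_eq hab.le hd]
    refine length_le_length hab hst' hd
      (continuousOn_fderiv_derivWithin hf (uniqueDiffOn_Icc hab) hc.contDiffOn hc.mapsTo)
      (fun x hx => (hγ.hasDerivWithinAt hf (hsub hx)).mono hsub)
      (fun x hx => (hγ.hasDerivWithinAt_velocity hf hU (hsub hx)).mono hsub) (hcz.mono hsub)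
      (fun x hx => hv x (hsub hx)) (by rw [hc.source]) (by rw [hc.target]) hD0 ?_ ?_
    · intro x hx σ hσ
      exact hB.abs_inner_le (hin hx) (hrr (hnear σ hσ).2) (hnear σ hσ).1.le
        (covariantDeriv_eq_zero_iff.1 (hgeo σ (hsub hσ)))
    · calc 2 * D * (t - s) ^ 2 ≤ 2 * D * (2 * ε) ^ 2 := by gcongr
        _ ≤ 1 := hε3.le
  -- The competitor starts within `r / 2` of the centre. It is followed only to distance `3r / 4`,
  -- still inside the ball where `f` is antilipschitz, and by then it has length at least `m * (r /
  -- 4)`.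
  · obtain ⟨x₁, hx₁, hout⟩ : ∃ x ∈ Icc a b, c x ∉ Metric.ball (γ t₀) r := by
      simpa [MapsTo, and_assoc] using hin
    have hca : ‖c a - γ t₀‖ < r / 2 := by
      rw [hc.source]; exact mem_ball_iff_norm.1 (hnear s (left_mem_Icc.2 hst)).2
    have hsub₁ : Icc a x₁ ⊆ Icc a b := Icc_subset_Icc_right hx₁.2
    obtain ⟨x₂, hx₂, hx₂r⟩ := intermediate_value_Icc hx₁.1
      ((hc.contDiffOn.continuousOn.mono hsub₁).sub continuousOn_const).norm
      (show 3 / 4 * r ∈ Icc ‖c a - γ t₀‖ ‖c x₁ - γ t₀‖ from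
        ⟨by linarith, by rw [mem_ball_iff_norm, not_lt] at hout; linarith⟩)
    have hx₂r : ‖c x₂ - γ t₀‖ = 3 / 4 * r := hx₂r
    have h1 := norm_sub_le_curveLength hf hab hc.contDiffOn hc.mapsTo (hsub₁ hx₂)
    have h2 := hB.antilipschitz (c x₂) (mem_ball_iff_norm.2 (by linarith)) (c a)
      (mem_ball_iff_norm.2 (by linarith))
    have h3 : r / 4 ≤ ‖c x₂ - c a‖ := by
      have := norm_sub_le_norm_sub_add_norm_sub (c x₂) (c a) (γ t₀)
      linarith
    have h4 : m * (r / 4) ≤ m * ‖c x₂ - c a‖ := by gcongr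
    have h5 : v * (t - s) ≤ v * (2 * ε) := by gcongr
    linarith

end Curves

/-! ### Locally minimal curves of constant speed are geodesics -/

/-- The first variation of length along a minimal arc is nonnegative in every direction. -/
theorem inner_acceleration_nonpos_of_isMinimalArc {f : ParamPlane → Space3} {Ω : Set ParamPlane}
    {γ : ℝ → ParamPlane} {G : Set ℝ} {v s t : ℝ} (hf : IsRegularSurface f Ω)
    (hU : UniqueDiffOn ℝ G) (hγ : IsRegularCurveOn f Ω γ G)
    (hv : ∀ x ∈ G, ‖velocity f γ G x‖ = v) (hst : s < t) (hsub : Icc s t ⊆ G)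
    (hmin : IsMinimalArc f Ω γ s t) {t₁ : ℝ} (ht₁ : t₁ ∈ Ioo s t) (e : ParamPlane) :
    inner ℝ (fderiv ℝ f (γ t₁) e) (derivWithin (velocity f γ G) G t₁) ≤ 0 := by
  by_contra! hpos
  set z := derivWithin (velocity f γ G) G with hz
  have hcz := hγ.continuousOn_acceleration hf hU
  have hγ1 : ContDiffOn ℝ 1 γ G := hγ.contDiffOn.of_le (by norm_num)
  have hcγ' := hγ1.continuousOn_derivWithin hU le_rfl
  have ht₁G : t₁ ∈ G := hsub (Ioo_subset_Icc_self ht₁)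
  obtain ⟨r, m, K, M, hB⟩ := hf.exists_immersionBounds (hγ.mapsTo ht₁G)
  have hr := hB.r_pos
  have hK := hB.K_nonneg
  have hM : 0 ≤ M := (norm_nonneg _).trans (hB.norm_fderiv_le _ (Metric.mem_ball_self hr))
  set κ := inner ℝ (fderiv ℝ f (γ t₁) e) (z t₁) / 2 with hκ
  have hκ0 : 0 < κ := by positivity
  set Z := ‖z t₁‖ + 1 with hZ
  set V := ‖derivWithin γ G t₁‖ + 1 with hV
  have hZ0 : 0 ≤ Z := by positivity
  have hV0 : 0 ≤ V := by positivity
  have hnG : G ∈ 𝓝 t₁ := Filter.mem_of_superset (Icc_mem_nhds ht₁.1 ht₁.2) hsub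
  have e1 : ∀ᶠ x in 𝓝 t₁, ‖z x‖ < Z :=
    (hcz.continuousAt hnG).norm.eventually (gt_mem_nhds (lt_add_one _))
  have e2 : ∀ᶠ x in 𝓝 t₁, ‖derivWithin γ G x‖ < V :=
    (hcγ'.continuousAt hnG).norm.eventually (gt_mem_nhds (lt_add_one _))
  have e3 : ∀ᶠ x in 𝓝 t₁, γ x ∈ Metric.ball (γ t₁) (r / 2) :=
    (hγ1.continuousOn.continuousAt hnG) (Metric.ball_mem_nhds _ (by positivity))
  have e4 : ∀ᶠ x in 𝓝 t₁, κ < inner ℝ (fderiv ℝ f (γ x) e) (z x) :=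
    ((((hf.continuousOn_fderiv.comp hγ1.continuousOn hγ.mapsTo).clm_apply
      continuousOn_const).inner hcz).continuousAt hnG).eventually (lt_mem_nhds (half_lt_self hpos))
  obtain ⟨R, hR, hRb⟩ := Metric.eventually_nhds_iff_ball.1
    ((((e1.and e2).and e3).and e4).and (Ioo_mem_nhds ht₁.1 ht₁.2))
  -- The bump lives where the bounds `e1`–`e4` hold and away from `s` and `t`, so the varied curve
  -- keeps its end points.
  let η : ContDiffBump t₁ := ⟨R / 2, R, by positivity, by linarith⟩
  have hηsupp : Function.support η = Metric.ball t₁ R := η.support_eq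
  have hη1 : ContDiff ℝ 1 η := η.contDiff
  have hηd : ∀ x, HasDerivAt η (deriv η x) x := fun x =>
    (hη1.differentiable (by norm_num) x).hasDerivAt
  obtain ⟨H, hH⟩ := isCompact_Icc.exists_bound_of_continuousOn (s := Icc s t)
    (hη1.continuous_deriv le_rfl).continuousOn
  have hH0 : 0 ≤ H := (norm_nonneg _).trans (hH s (left_mem_Icc.2 hst.le))
  have hηout : ∀ x, x ∉ Metric.ball t₁ R → η x = 0 := fun x hx => by
    rwa [← hηsupp, Function.notMem_support] at hx
  -- Points outside the open ball, its boundary included, are minima of `η ≥ 0`.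
  have hη'out : ∀ x, x ∉ Metric.ball t₁ R → deriv η x = 0 := fun x hx =>
    IsLocalMin.deriv_eq_zero (Filter.Eventually.of_forall fun y => by
      rw [hηout x hx]; exact η.nonneg)
  have hηs : η s = 0 := hηout s fun hs => lt_irrefl _ (hRb s hs).2.1
  have hηt : η t = 0 := hηout t fun ht => lt_irrefl _ (hRb t ht).2.2
  have hI : 0 < ∫ x in s..t, η x :=
    intervalIntegral.integral_pos hst hη1.continuous.continuousOn (fun _ _ => η.nonneg)
      ⟨t₁, Ioo_subset_Icc_self ht₁, η.pos_of_mem_ball (Metric.mem_ball_self hR)⟩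
  set I := ∫ x in s..t, η x with hIdef
  -- Coefficient of the second-order losses: the Taylor remainder paired with the acceleration, and
  -- the squared change of velocity. The first-order gain `2κI` beats them for small `ε`.
  set C := 2 * (K * ‖e‖ ^ 2 * Z) + (K * ‖e‖ * V + H * M * ‖e‖) ^ 2 with hC
  have l1 : ∀ᶠ ε : ℝ in 𝓝[>] 0, ε * ‖e‖ < r / 2 := by
    have : Filter.Tendsto (fun ε : ℝ => ε * ‖e‖) (𝓝 0) (𝓝 (0 * ‖e‖)) :=
      (by fun_prop : Continuous fun ε : ℝ => ε * ‖e‖).tendsto 0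
    exact (this.mono_left nhdsWithin_le_nhds).eventually
      (gt_mem_nhds (by rw [zero_mul]; positivity))
  have l2 : ∀ᶠ ε : ℝ in 𝓝[>] 0, ε * (C * (t - s)) < 2 * κ * I := by
    have : Filter.Tendsto (fun ε : ℝ => ε * (C * (t - s))) (𝓝 0) (𝓝 (0 * (C * (t - s)))) :=
      (by fun_prop : Continuous fun ε : ℝ => ε * (C * (t - s))).tendsto 0
    exact (this.mono_left nhdsWithin_le_nhds).eventually
      (gt_mem_nhds (by rw [zero_mul]; positivity))
  obtain ⟨ε, ⟨hε1, hε2⟩, hε⟩ := ((l1.and l2).and eventually_mem_nhdsWithin).exists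
  have hε : 0 < ε := hε
  set c : ℝ → ParamPlane := fun x => γ x + (ε * η x) • e with hc
  have hcout : ∀ x, x ∉ Metric.ball t₁ R → c x = γ x := fun x hx => by simp [hc, hηout x hx]
  have hcsub : ∀ x, ‖c x - γ x‖ = ε * η x * ‖e‖ := fun x => by
    rw [hc, add_sub_cancel_left, norm_smul, Real.norm_of_nonneg (mul_nonneg hε.le η.nonneg)]
  have hcle : ∀ x, ‖c x - γ x‖ ≤ ε * ‖e‖ := fun x => by
    rw [hcsub]
    have : ε * η x ≤ ε * 1 := mul_le_mul_of_nonneg_left η.le_one hε.le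
    nlinarith [norm_nonneg e]
  have hγin : ∀ x ∈ Metric.ball t₁ R, γ x ∈ Metric.ball (γ t₁) r := fun x hx =>
    Metric.ball_subset_ball (by linarith) (hRb x hx).1.1.2
  have hcin : ∀ x ∈ Metric.ball t₁ R, c x ∈ Metric.ball (γ t₁) r := fun x hx => by
    have h1 := mem_ball_iff_norm.1 (hRb x hx).1.1.2
    have h2 := norm_sub_le_norm_sub_add_norm_sub (c x) (γ x) (γ t₁)
    exact mem_ball_iff_norm.2 (by linarith [hcle x])
  have hcmaps : MapsTo c (Icc s t) Ω := fun x hx => by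
    by_cases hxR : x ∈ Metric.ball t₁ R
    · exact hB.subset (hcin x hxR)
    · rw [hcout x hxR]; exact hγ.mapsTo (hsub hx)
  have hcC : ContDiffOn ℝ 1 c (Icc s t) :=
    (hγ1.mono hsub).add ((contDiffOn_const.mul hη1.contDiffOn).smul contDiffOn_const)
  have hcd : ∀ x ∈ Icc s t,
      derivWithin c (Icc s t) x = derivWithin γ G x + (ε * deriv η x) • e := fun x hx =>
    (((hγ1.differentiableOn (by norm_num) x (hsub hx)).hasDerivWithinAt.mono hsub).add
      (((hηd x).const_mul ε).smul_const e).hasDerivWithinAt).derivWithin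
      (uniqueDiffOn_Icc hst x hx)
  have hcs : c s = γ s := by simp [hc, hηs]
  have hct : c t = γ t := by simp [hc, hηt]
  have hd := fun x (hx : x ∈ Icc s t) => hasDerivWithinAt_comp hf hcC hcmaps hx
  have hp := continuousOn_fderiv_derivWithin hf (uniqueDiffOn_Icc hst) hcC hcmaps
  have hle := surfaceDist_le_curveLength (f := f) ⟨hst.le, hcC, hcmaps, hcs, hct⟩
  rw [← hmin, hγ.curveLength_eq hf hst.le hsub, curveLength_eq hst.le hd] at hle
  have hfv := two_mul_integral_inner_le hst hd hp
    (fun x hx => (hγ.hasDerivWithinAt hf (hsub hx)).mono hsub)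
    (fun x hx => (hγ.hasDerivWithinAt_velocity hf hU (hsub hx)).mono hsub) (hcz.mono hsub)
    (fun x hx => hv x (hsub hx)) (by rw [hcs]) (by rw [hct]) hle
  have hlow : ∀ x ∈ Icc s t, 2 * ε * κ * η x - ε ^ 2 * C ≤
      2 * inner ℝ (f (c x) - f (γ x)) (z x)
        - ‖fderiv ℝ f (c x) (derivWithin c (Icc s t) x) - velocity f γ G x‖ ^ 2 := by
    intro x hx
    rw [hcd x hx, hγ.velocity_eq hf hU (hsub hx)]
    by_cases hxR : x ∈ Metric.ball t₁ R
    · obtain ⟨⟨⟨⟨hzx, hVx⟩, -⟩, hκx⟩, -⟩ := hRb x hxR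
      have hT := hB.taylor _ (hcin x hxR) _ (hγin x hxR)
      have hL := hB.lipschitz _ (hcin x hxR) _ (hγin x hxR)
      have hcγ : c x - γ x = (ε * η x) • e := by simp [hc]
      have h1 : ε * η x * κ ≤ inner ℝ (fderiv ℝ f (γ x) (c x - γ x)) (z x) := by
        rw [hcγ, map_smul, real_inner_smul_left]
        exact mul_le_mul_of_nonneg_left hκx.le (mul_nonneg hε.le η.nonneg)
      have h2 : -(K * (ε * ‖e‖) ^ 2 * Z) ≤
          inner ℝ (f (c x) - f (γ x) - fderiv ℝ f (γ x) (c x - γ x)) (z x) := by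
        refine neg_le_of_abs_le ((abs_real_inner_le_norm _ _).trans ?_)
        calc _ ≤ K * ‖c x - γ x‖ ^ 2 * Z := by gcongr
          _ ≤ _ := by gcongr; exact hcle x
      rw [inner_sub_left (f (c x) - f (γ x))] at h2
      have h3 : ‖fderiv ℝ f (c x) (derivWithin γ G x + (ε * deriv η x) • e)
          - fderiv ℝ f (γ x) (derivWithin γ G x)‖ ≤ ε * (K * ‖e‖ * V + H * M * ‖e‖) := by
        have e0 : fderiv ℝ f (c x) (derivWithin γ G x + (ε * deriv η x) • e)
          - fderiv ℝ f (γ x) (derivWithin γ G x) =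
          (fderiv ℝ f (c x) - fderiv ℝ f (γ x)) (derivWithin γ G x)
            + (ε * deriv η x) • fderiv ℝ f (c x) e := by
          rw [map_add, map_smul, sub_apply]; abel
        have n1 : ‖(fderiv ℝ f (c x) - fderiv ℝ f (γ x)) (derivWithin γ G x)‖
            ≤ K * (ε * ‖e‖) * V := by
          refine (ContinuousLinearMap.le_opNorm _ _).trans ?_
          gcongr
          exact hL.trans (mul_le_mul_of_nonneg_left (hcle x) hK)
        have n2 : ‖(ε * deriv η x) • fderiv ℝ f (c x) e‖ ≤ ε * H * (M * ‖e‖) := by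
          rw [norm_smul, norm_mul, Real.norm_of_nonneg hε.le]
          gcongr
          · exact hH x hx
          · exact (ContinuousLinearMap.le_opNorm _ _).trans
              (mul_le_mul_of_nonneg_right (hB.norm_fderiv_le _ (hcin x hxR)) (norm_nonneg _))
        rw [e0]
        refine (norm_add_le _ _).trans ((add_le_add n1 n2).trans (le_of_eq ?_))
        ring
      have h4 := pow_le_pow_left₀ (norm_nonneg _) h3 2
      rw [mul_pow] at h4
      have e5 : ε ^ 2 * C = 2 * (K * (ε * ‖e‖) ^ 2 * Z)
          + ε ^ 2 * (K * ‖e‖ * V + H * M * ‖e‖) ^ 2 := by rw [hC]; ring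
      rw [e5]
      linarith
    · have : 0 ≤ ε ^ 2 * C := by positivity
      simp [hcout x hxR, hηout x hxR, hη'out x hxR, this]
  have hcc : ContinuousOn (fun x => f (c x)) (Icc s t) := fun x hx => (hd x hx).continuousWithinAt
  have hcy : ContinuousOn (fun x => f (γ x)) (Icc s t) :=
    (hγ.contDiffOn_comp hf).continuousOn.mono hsub
  have hiη := hη1.continuous.intervalIntegrable (μ := MeasureTheory.volume) s t
  have hint : ∫ x in s..t, (2 * ε * κ * η x - ε ^ 2 * C) ≤ _ :=
    intervalIntegral.integral_mono_on hst.le ((hiη.const_mul _).sub (by simp))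
      (((continuousOn_const.mul ((hcc.sub hcy).inner (hcz.mono hsub))).sub
        ((hp.sub ((hγ.contDiffOn_velocity hf hU).continuousOn.mono hsub)).norm.pow
          2)).intervalIntegrable_of_Icc hst.le) hlow
  rw [intervalIntegral.integral_sub (hiη.const_mul _) (by simp),
    intervalIntegral.integral_const_mul, ← hIdef, intervalIntegral.integral_const,
    smul_eq_mul] at hint
  have hfin : ε * (2 * κ * I - ε * (C * (t - s))) ≤ 0 := by
    have := hint.trans hfv
    linarith
  exact absurd hfin (not_le.2 (mul_pos hε (sub_pos.2 hε2)))

/-- A constant speed curve that is locally minimal is a geodesic. -/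
theorem isGeodesicOn_of_isMinimalArc {f : ParamPlane → Space3} {Ω : Set ParamPlane}
    {γ : ℝ → ParamPlane} {G : Set ℝ} {v : ℝ} (hf : IsRegularSurface f Ω)
    (hG : G.OrdConnected) (hG' : G.Nontrivial) (hγ : IsRegularCurveOn f Ω γ G)
    (hv : ∀ x ∈ G, ‖velocity f γ G x‖ = v)
    (hmin : ∀ t₀ ∈ G, ∃ s ∈ G, ∃ t ∈ G, s < t ∧ Icc s t ∈ 𝓝[G] t₀ ∧ IsMinimalArc f Ω γ s t) :
    IsGeodesicOn f Ω γ G := by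
  have hU := hG.uniqueDiffOn hG'
  refine ⟨hγ, fun t₀ ht₀ => covariantDeriv_eq_zero_iff.2 fun e => ?_⟩
  obtain ⟨s, hs, t, ht, hst, hnhds, hm⟩ := hmin t₀ ht₀
  have hsub : Icc s t ⊆ G := hG.out hs ht
  -- The inequality for `e` and for `-e` gives equality on the open interval. Continuity carries it
  -- to the closed one, which is needed when `t₀` is an end point of `G`.
  have hzero : EqOn (fun x => inner ℝ (fderiv ℝ f (γ x) e) (derivWithin (velocity f γ G) G x))
      (fun _ => (0 : ℝ)) (Ioo s t) := fun x hx => by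
    refine le_antisymm
      (inner_acceleration_nonpos_of_isMinimalArc hf hU hγ hv hst hsub hm hx e) ?_
    have := inner_acceleration_nonpos_of_isMinimalArc hf hU hγ hv hst hsub hm hx (-e)
    rw [map_neg, inner_neg_left] at this
    exact neg_nonpos.1 this
  have hcont : ContinuousOn
      (fun x => inner ℝ (fderiv ℝ f (γ x) e) (derivWithin (velocity f γ G) G x) : ℝ → ℝ)
      (Icc s t) :=
    (((hf.continuousOn_fderiv.comp hγ.contDiffOn.continuousOn hγ.mapsTo).clm_apply
      continuousOn_const).inner (hγ.continuousOn_acceleration hf hU)).mono hsub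
  exact hzero.of_subset_closure hcont continuousOn_const Ioo_subset_Icc_self
    (closure_Ioo hst.ne).ge (mem_of_mem_nhdsWithin ht₀ hnhds)

/-- On a regular surface, the geodesics are the constant-speed curves that locally realise the
distance between their points. -/
theorem mainTheorem8 (f : ParamPlane → Space3) (Ω : Set ParamPlane)
    (hf : IsRegularSurface f Ω)
    (G : Set ℝ) (hG : G.OrdConnected) (hG' : G.Nontrivial)
    (γ : ℝ → ParamPlane) (hγ : IsRegularCurveOn f Ω γ G) :
    (IsGeodesicOn f Ω γ G →
      (∃ v : ℝ, ∀ t ∈ G, ‖velocity f γ G t‖ = v) ∧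
      ∀ t₀ ∈ G, ∃ ε > 0, ∀ s ∈ G, ∀ t ∈ G, |s - t₀| < ε → |t - t₀| < ε → s ≤ t →
        IsMinimalArc f Ω γ s t) ∧
    ((∃ v : ℝ, ∀ t ∈ G, ‖velocity f γ G t‖ = v) →
      (∀ t₀ ∈ G, ∃ s ∈ G, ∃ t ∈ G, s < t ∧ Icc s t ∈ 𝓝[G] t₀ ∧ IsMinimalArc f Ω γ s t) →
      IsGeodesicOn f Ω γ G) := by
  refine ⟨fun h => ?_, fun ⟨v, hv⟩ hmin => isGeodesicOn_of_isMinimalArc hf hG hG' hγ hv hmin⟩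
  obtain ⟨v, hv⟩ := h.exists_norm_velocity_eq hf hG hG'
  exact ⟨⟨v, hv⟩, fun t₀ ht₀ => h.exists_isMinimalArc hf hG hG' hv ht₀⟩
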